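/- Let $L=(L_t)_{t\ge 0}$ be a real-valued Lévy process with $L_0=0$ a.s. on a probability space $(\Omega,\mathcal F,\mathbb P)$, not identically zero, and let $\eta:\mathbb R\to\mathbb C$ be its characteristic exponent, i.e. $\mathbb E[e^{iuL_t}]=e^{t\eta(u)}$ for all $u\in\mathbb R$, $t\ge 0$. Write $C_0(\mathbb R)$ for the continuous functions $\mathbb R\to\mathbb R$ vanishing at infinity, and $C_0^2(\mathbb R)$ for the twice continuously differentiable functions which lie, together with their first two derivatives, in $C_0(\mathbb R)$. For $f\in C_0(\mathbb R)$ put $P_tf(x)=\mathbb E[f(L_t+x)]$, and let $$D(\mathcal A)=\Big\{f\in C_0(\mathbb R): \lim_{t\downarrow0}t^{-1}(P_tf-f)\text{ exists uniformly, as an element of } C_0(\mathbb R)\Big\}$$ be the domain of the generator $\mathcal A$ of $L$. Let $D(\mathcal A^*)$ be the domain of the generator $\mathcal A^*$ of the dual process $-L$, defined in the same way. Let $\mu_0,\mu_1$ be probability measures on $\mathbb R$ with strictly positive Lebesgue densities $h_0,h_1$, and write $\widehat\mu(u)=\int_{\mathbb R}e^{iux}\,\mu(dx)$. Suppose that at least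 one of the following holds: - (type S) $L$ is symmetric, $\int_1^\infty |\eta(u)|^{-1}\,du<\infty$, and $h_0,h_1\in C_0(\mathbb R)$; - (type 0) $\liminf_{u\to\infty}|\eta(u)|\in(0,\infty]$, $h_0,h_1\in C_0^2(\mathbb R)$, and $h_i^{(k)}\in L^1(\mathbb R)$ for $k=1,2$ and $i=0,1$; - (type D) $\liminf_{u\to\infty}|\eta(u)|=0$, and $\widehat{\mu_1}-\widehat{\mu_0}$ is continuous with compact support. Suppose also that $$\frac{\widehat{\mu_1}-\widehat{\mu_0}}{\eta}\in L^1(\mathbb R),\qquad H\ge 0,\qquad H\in L^1(\mathbb R),$$ where $$H(x)=\frac1{2\pi}\int_{\mathbb R}\frac{\widehat{\mu_1}(\xi)-\widehat{\mu_0}(\xi)}{\eta(\xi)}\,e^{-ix\xi}\,d\xi,\qquad x\in\mathbb R$$ (this function is real-valued). Then $H\in D(\mathcal A)\cap D(\mathcal A^*)$. -/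

import Mathlib

open MeasureTheory ProbabilityTheory Filter Topology
open scoped NNReal ENNReal

namespace LevySEP

/-- A real-valued Lévy process issued from `0`: almost surely `X 0 = 0`, independent and stationary
increments, stochastic continuity, and almost surely right-continuous paths with left limits. -/
structure IsLevyProcess {Ω : Type*} [MeasurableSpace Ω] (X : ℝ≥0 → Ω → ℝ) (P : Measure Ω) :
    Prop where
  measurable : ∀ t, Measurable (X t)
  start_zero : ∀ᵐ ω ∂P, X 0 ω = 0
  indep_increments : HasIndepIncrements X P
  stationary_increments : ∀ s t : ℝ≥0,
    IdentDistrib (fun ω => X (s + t) ω - X s ω) (fun ω => X t ω - X 0 ω) P P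
  stochastically_continuous : ∀ t : ℝ≥0, TendstoInMeasure P X (𝓝 t) (X t)
  rcll : ∀ᵐ ω ∂P, ∀ t : ℝ≥0, ContinuousWithinAt (fun s => X s ω) (Set.Ici t) t ∧
    ∃ l : ℝ, Tendsto (fun s => X s ω) (𝓝[<] t) (𝓝 l)

/-- The dual process `-X`. -/
def dualProcess {Ω : Type*} (X : ℝ≥0 → Ω → ℝ) : ℝ≥0 → Ω → ℝ := fun t ω => - X t ω

/-- `η` is the characteristic exponent of `X`, that is, `E[exp (i u X_t)] = exp (t η(u))` for all
real `u` and all `t ≥ 0`. This determines `η` uniquely (see `IsCharExponent.unique`). -/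
def IsCharExponent {Ω : Type*} [MeasurableSpace Ω] (X : ℝ≥0 → Ω → ℝ) (P : Measure Ω)
    (η : ℝ → ℂ) : Prop :=
  ∀ (t : ℝ≥0) (u : ℝ), charFun (P.map (X t)) u = Complex.exp (((t : ℝ) : ℂ) * η u)

/-- The transition semigroup `P_t f (x) = E[f (X_t + x)]`. -/
noncomputable def transition {Ω : Type*} [MeasurableSpace Ω] (X : ℝ≥0 → Ω → ℝ) (P : Measure Ω)
    (t : ℝ≥0) (f : ℝ → ℝ) (x : ℝ) : ℝ :=
  ∫ ω, f (X t ω + x) ∂P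

/-- The domain of the infinitesimal generator of `X` on `C₀(ℝ)`: the functions `f` in `C₀(ℝ)` for
which `(P_t f - f) / t` converges uniformly to some `g` in `C₀(ℝ)` as `t ↓ 0`. -/
def generatorDomain {Ω : Type*} [MeasurableSpace Ω] (X : ℝ≥0 → Ω → ℝ) (P : Measure Ω) :
    Set (ℝ → ℝ) :=
  {f | ∃ F g : ZeroAtInftyContinuousMap ℝ ℝ, ⇑F = f ∧
    TendstoUniformly (fun (t : ℝ≥0) (x : ℝ) => (transition X P t f x - f x) / (t : ℝ)) g (𝓝[>] 0)}

/-- `C₀ⁿ(ℝ)`: `n` times differentiable functions all of whose derivatives of order at most `n`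
(including the function itself) are continuous and vanish at infinity. -/
def IsC0n (n : ℕ) (f : ℝ → ℝ) : Prop :=
  ContDiff ℝ n f ∧ ∀ k : ℕ, k ≤ n → Tendsto (iteratedDeriv k f) (cocompact ℝ) (𝓝 0)

/-- The process is symmetric: `X_t` and `-X_t` have the same law. -/
def IsSymmetricProcess {Ω : Type*} [MeasurableSpace Ω] (X : ℝ≥0 → Ω → ℝ) (P : Measure Ω) : Prop :=
  ∀ t : ℝ≥0, P.map (X t) = P.map (dualProcess X t)

/-- Type S: symmetric, and `1 / |η|` is integrable on `(1, ∞)` (with `1 / 0 = ∞`). -/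
def IsTypeS {Ω : Type*} [MeasurableSpace Ω] (X : ℝ≥0 → Ω → ℝ) (P : Measure Ω) (η : ℝ → ℂ) : Prop :=
  IsSymmetricProcess X P ∧ ∫⁻ u in Set.Ioi (1 : ℝ), (‖η u‖ₑ)⁻¹ < ∞

/-- Type 0: `liminf_{u → ∞} |η(u)|` lies in `(0, ∞]`. -/
def IsTypeZero (η : ℝ → ℂ) : Prop := 0 < liminf (fun u : ℝ => ‖η u‖ₑ) atTop

/-- Type D: `liminf_{u → ∞} |η(u)| = 0`. -/
def IsTypeD (η : ℝ → ℂ) : Prop := liminf (fun u : ℝ => ‖η u‖ₑ) atTop = 0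

/-- `h` is a strictly positive Lebesgue density of `μ`. -/
def IsPositiveDensity (μ : Measure ℝ) (h : ℝ → ℝ) : Prop :=
  Measurable h ∧ (∀ x, 0 < h x) ∧ μ = volume.withDensity (fun x => ENNReal.ofReal (h x))

/-- The regularity assumptions on the densities, according to the type of the process. Types may
overlap (type S and type 0); the assumption attached to one type of the process is enough. The
Fourier transform of a measure `μ` is `charFun μ`, i.e. `u ↦ ∫ exp (i u x) dμ(x)`. -/
def RegularityAssumption {Ω : Type*} [MeasurableSpace Ω] (X : ℝ≥0 → Ω → ℝ) (P : Measure Ω)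
    (η : ℝ → ℂ) (μ₀ μ₁ : Measure ℝ) (h₀ h₁ : ℝ → ℝ) : Prop :=
  (IsTypeS X P η ∧ IsC0n 0 h₀ ∧ IsC0n 0 h₁) ∨
  (IsTypeZero η ∧
    (IsC0n 2 h₀ ∧ Integrable (iteratedDeriv 1 h₀) ∧ Integrable (iteratedDeriv 2 h₀)) ∧
    (IsC0n 2 h₁ ∧ Integrable (iteratedDeriv 1 h₁) ∧ Integrable (iteratedDeriv 2 h₁))) ∨
  (IsTypeD η ∧ Continuous (fun u => charFun μ₁ u - charFun μ₀ u) ∧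
    HasCompactSupport (fun u => charFun μ₁ u - charFun μ₀ u))

/-- The function `(1 / 2π) ∫ (μ̂₁(ξ) - μ̂₀(ξ)) / η(ξ) * exp (-i x ξ) dξ`, a priori complex. -/
noncomputable def potentialC (μ₀ μ₁ : Measure ℝ) (η : ℝ → ℂ) (x : ℝ) : ℂ :=
  1 / (2 * (Real.pi : ℂ)) *
    ∫ ξ : ℝ, (charFun μ₁ ξ - charFun μ₀ ξ) / η ξ * Complex.exp (-Complex.I * x * ξ)

/-- The function `H`, as a real-valued function. For the exponent of a process `potentialC` is
real (see `potential_coe`), so that taking the real part loses nothing. -/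
noncomputable def potential (μ₀ μ₁ : Measure ℝ) (η : ℝ → ℂ) (x : ℝ) : ℝ :=
  (potentialC μ₀ μ₁ η x).re

/-- The condition `(μ̂₁ - μ̂₀) / η ∈ L¹(ℝ)`, `H ≥ 0` and `H ∈ L¹(ℝ)`. -/
def EmbeddingCondition (μ₀ μ₁ : Measure ℝ) (η : ℝ → ℂ) : Prop :=
  Integrable (fun ξ : ℝ => (charFun μ₁ ξ - charFun μ₀ ξ) / η ξ) ∧
  (∀ x, 0 ≤ potential μ₀ μ₁ η x) ∧
  Integrable (potential μ₀ μ₁ η)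

theorem eq_of_exp_mul_eq {a b : ℂ}
    (h : ∀ t : ℝ≥0, Complex.exp (((t : ℝ) : ℂ) * a) = Complex.exp (((t : ℝ) : ℂ) * b)) :
    a = b := by
  by_contra hab
  have hc : a - b ≠ 0 := sub_ne_zero.mpr hab
  have hn : 0 < ‖a - b‖ := norm_pos_iff.mpr hc
  have h1 := h ‖a - b‖₊⁻¹
  rw [Complex.exp_eq_exp_iff_exists_int] at h1
  obtain ⟨n, hn1⟩ := h1
  have h2 : (((‖a - b‖₊⁻¹ : ℝ≥0) : ℝ) : ℂ) * (a - b) = n * (2 * Real.pi * Complex.I) := by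
    rw [mul_sub, hn1]; ring
  have h3 := congrArg norm h2
  simp only [NNReal.coe_inv, coe_nnnorm, norm_mul, Complex.norm_real, norm_inv,
    Complex.norm_I, mul_one, Complex.norm_intCast, Complex.norm_ofNat, Real.norm_eq_abs,
    abs_of_pos Real.pi_pos] at h3
  rw [abs_of_pos hn, inv_mul_cancel₀ hn.ne'] at h3
  have hpi := Real.pi_gt_three
  rcases eq_or_ne n 0 with rfl | h0
  · simp at h3
  · have : (1 : ℝ) ≤ |(n : ℝ)| := by exact_mod_cast Int.one_le_abs h0
    nlinarith

theorem IsCharExponent.unique {Ω : Type*} [MeasurableSpace Ω] {X : ℝ≥0 → Ω → ℝ} {P : Measure Ω}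
    {η η' : ℝ → ℂ} (h : IsCharExponent X P η) (h' : IsCharExponent X P η') : η = η' := by
  funext u
  exact eq_of_exp_mul_eq fun t => by rw [← h t u, ← h' t u]

theorem IsCharExponent.neg {Ω : Type*} [MeasurableSpace Ω] {X : ℝ≥0 → Ω → ℝ} {P : Measure Ω}
    {η : ℝ → ℂ} (h : IsCharExponent X P η) (u : ℝ) : η (-u) = (starRingEnd ℂ) (η u) := by
  refine eq_of_exp_mul_eq fun t => ?_
  rw [← h t (-u), charFun_neg, h t u, ← Complex.exp_conj, map_mul, Complex.conj_ofReal]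

theorem potential_coe {Ω : Type*} [MeasurableSpace Ω] {X : ℝ≥0 → Ω → ℝ} {P : Measure Ω}
    {η : ℝ → ℂ} (h : IsCharExponent X P η) (μ₀ μ₁ : Measure ℝ) (x : ℝ) :
    (potential μ₀ μ₁ η x : ℂ) = potentialC μ₀ μ₁ η x := by
  rw [potential, ← Complex.conj_eq_iff_re, potentialC, map_mul, ← integral_conj,
    ← integral_neg_eq_self]
  congr 1
  · simp [Complex.conj_ofNat]
  · congr 1
    funext ξ
    simp [charFun_neg, h.neg, ← Complex.exp_conj]

end LevySEP

/-!
Write `φ = μ̂₁ - μ̂₀` and `ψ = φ / η`, so that the potential `H` is the inverse Fourier transform of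
the integrable function `ψ`. Averaging over the law of `L_t` multiplies the integrand by
`exp (t η̄)` (`transition_coe`), hence `(P_t H - H) / t` is the inverse Fourier transform of
`ψ (exp (t η̄) - 1) / t`; for the dual process `η̄` is replaced by `η`. The function `H` itself is
in `C₀(ℝ)` by the Riemann–Lebesgue lemma.

If `φ` is integrable, which covers the types 0 and D, then since `Re η ≤ 0` these integrands are
bounded by `|φ|`. By dominated convergence they converge in `L¹`, so that the difference quotients
converge uniformly to an element of `C₀(ℝ)` (`mem_generatorDomain_of_integrable_mul`). For type D
the function `φ` is continuous with compact support; for type 0 it decays quadratically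
(`integrable_charFun_of_contDiff_two`).

For type S the function `φ` need not be integrable, but `η` is real and nonzero almost everywhere
(`IsCharExponent.ae_ne_zero`), so `ψ η̄ = φ` is the Fourier transform of `g = h₁ - h₀`, an integrable
element of `C₀(ℝ)`. The continuous integrable function `∫₀ᵗ P_s g ds` has Fourier transform
`φ ∫₀ᵗ exp (s η) ds = ψ (exp (t η) - 1)`, which is integrable. Fourier inversion gives
`P_t H - H = ∫₀ᵗ P_s g ds`, and the averages of `P_s g` over `[0, t]` converge uniformly to `g` as
`t ↓ 0`, because stochastic continuity makes the semigroup strongly continuous on `C₀(ℝ)`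
(`mem_generatorDomain_of_fourier_eq`).
-/

namespace LevySEP

open scoped FourierTransform ComplexConjugate

/-! ### The inverse Fourier transform -/

/-- The inverse Fourier transform `(1 / 2π) ∫ ψ(ξ) exp (-i x ξ) dξ`, in the normalization that
inverts characteristic functions. -/
noncomputable def invFourier (ψ : ℝ → ℂ) (x : ℝ) : ℂ :=
  1 / (2 * (Real.pi : ℂ)) * ∫ ξ : ℝ, ψ ξ * Complex.exp (-Complex.I * x * ξ)

theorem norm_exp_neg_I_mul (x ξ : ℝ) : ‖Complex.exp (-Complex.I * x * ξ)‖ = 1 := by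
  rw [show -Complex.I * x * ξ = ((-(x * ξ) : ℝ) : ℂ) * Complex.I by push_cast; ring,
    Complex.norm_exp_ofReal_mul_I]

theorem invFourier_eq_fourier (ψ : ℝ → ℂ) (x : ℝ) :
    invFourier ψ x = 1 / (2 * (Real.pi : ℂ)) * 𝓕 ψ (x / (2 * Real.pi)) := by
  rw [invFourier, Real.fourier_real_eq_integral_exp_smul]
  congr 2
  funext ξ
  rw [smul_eq_mul, mul_comm]
  congr 2
  have : (Real.pi : ℂ) ≠ 0 := by exact_mod_cast Real.pi_ne_zero
  push_cast
  field_simp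

theorem continuous_invFourier {ψ : ℝ → ℂ} (hψ : Integrable ψ) : Continuous (invFourier ψ) := by
  refine continuous_const.mul (continuous_of_dominated (bound := fun ξ => ‖ψ ξ‖) (fun x => ?_)
    (fun x => ?_) hψ.norm ?_)
  · exact hψ.aestronglyMeasurable.mul (by fun_prop)
  · filter_upwards with ξ
    rw [norm_mul, norm_exp_neg_I_mul, mul_one]
  · filter_upwards with ξ
    fun_prop

/-- The Riemann–Lebesgue lemma for `invFourier`. -/
theorem tendsto_invFourier_cocompact (ψ : ℝ → ℂ) :
    Tendsto (invFourier ψ) (cocompact ℝ) (𝓝 0) := by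
  have h2π : (2 * Real.pi)⁻¹ ≠ 0 := by positivity
  have h1 : Tendsto (fun x : ℝ => x / (2 * Real.pi)) (cocompact ℝ) (cocompact ℝ) := by
    simpa [div_eq_mul_inv] using
      (Homeomorph.mulRight₀ (2 * Real.pi)⁻¹ h2π).isClosedEmbedding.tendsto_cocompact
  have h2 := ((Real.zero_at_infty_fourier ψ).comp h1).const_mul (1 / (2 * (Real.pi : ℂ)))
  rw [mul_zero] at h2
  exact h2.congr fun x => (invFourier_eq_fourier ψ x).symm

theorem exists_C0_eq_re_invFourier {ψ : ℝ → ℂ} (hψ : Integrable ψ) :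
    ∃ F : ZeroAtInftyContinuousMap ℝ ℝ, ∀ x, F x = (invFourier ψ x).re := by
  refine ⟨⟨⟨fun x => (invFourier ψ x).re, Complex.continuous_re.comp (continuous_invFourier hψ)⟩,
    ?_⟩, fun x => rfl⟩
  have := (Complex.continuous_re.tendsto 0).comp (tendsto_invFourier_cocompact ψ)
  simpa [Function.comp_def] using this

theorem integrable_mul_exp {ψ : ℝ → ℂ} (hψ : Integrable ψ) (x : ℝ) :
    Integrable (fun ξ : ℝ => ψ ξ * Complex.exp (-Complex.I * x * ξ)) := by
  refine hψ.norm.mono' (hψ.aestronglyMeasurable.mul (by fun_prop)) ?_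
  filter_upwards with ξ
  rw [norm_mul, norm_exp_neg_I_mul, mul_one]

theorem invFourier_sub {ψ χ : ℝ → ℂ} (hψ : Integrable ψ) (hχ : Integrable χ) (x : ℝ) :
    invFourier ψ x - invFourier χ x = invFourier (fun ξ => ψ ξ - χ ξ) x := by
  simp only [invFourier, sub_mul]
  rw [integral_sub (integrable_mul_exp hψ x) (integrable_mul_exp hχ x), mul_sub]

theorem invFourier_div_const (ψ : ℝ → ℂ) (c : ℂ) (x : ℝ) :
    invFourier ψ x / c = invFourier (fun ξ => ψ ξ / c) x := by
  simp only [invFourier, div_mul_eq_mul_div]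
  rw [integral_div]
  ring

theorem norm_invFourier_le (ψ : ℝ → ℂ) (x : ℝ) : ‖invFourier ψ x‖ ≤ ∫ ξ, ‖ψ ξ‖ := by
  have h1 : ‖∫ ξ : ℝ, ψ ξ * Complex.exp (-Complex.I * x * ξ)‖ ≤ ∫ ξ, ‖ψ ξ‖ := by
    refine (norm_integral_le_integral_norm _).trans_eq (integral_congr_ae ?_)
    filter_upwards with ξ
    rw [norm_mul, norm_exp_neg_I_mul, mul_one]
  have h2 : ‖1 / (2 * (Real.pi : ℂ))‖ ≤ 1 := by
    rw [norm_div, norm_one, norm_mul, Complex.norm_ofNat, Complex.norm_real, Real.norm_eq_abs,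
      abs_of_pos Real.pi_pos, div_le_one (by positivity)]
    linarith [Real.pi_gt_three]
  rw [invFourier, norm_mul]
  exact (mul_le_of_le_one_left (norm_nonneg _) h2).trans h1

/-- Averaging an inverse Fourier transform over random translations multiplies the integrand by
the conjugate characteristic function. -/
theorem integral_invFourier_add {Ω : Type*} [MeasurableSpace Ω] {P : Measure Ω}
    [IsProbabilityMeasure P] {X : Ω → ℝ} (hX : Measurable X) {ψ : ℝ → ℂ} (hψ : Integrable ψ)
    (x : ℝ) :
    ∫ ω, invFourier ψ (X ω + x) ∂P =
      invFourier (fun ξ => ψ ξ * conj (charFun (P.map X) ξ)) x := by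
  simp only [invFourier]
  rw [integral_const_mul, integral_integral_swap]
  · congr 2
    funext ξ
    rw [← charFun_neg, charFun_apply_real, integral_map hX.aemeasurable (by fun_prop),
      mul_assoc, mul_comm _ (Complex.exp _), ← integral_const_mul, ← integral_const_mul]
    congr 1
    funext ω
    rw [← Complex.exp_add]
    congr 2
    push_cast
    ring
  · refine (hψ.comp_snd P).norm.mono' ((hψ.comp_snd P).aestronglyMeasurable.mul ?_) ?_
    · exact Measurable.aestronglyMeasurable (by fun_prop)
    · filter_upwards with p
      simp only [Function.uncurry]
      rw [norm_mul, norm_exp_neg_I_mul, mul_one]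

/-! ### Characteristic exponents -/

theorem IsCharExponent.dual {Ω : Type*} [MeasurableSpace Ω] {P : Measure Ω} {X : ℝ≥0 → Ω → ℝ}
    {θ : ℝ → ℂ} (hX : ∀ t, Measurable (X t)) (hθ : IsCharExponent X P θ) :
    IsCharExponent (dualProcess X) P (fun u => conj (θ u)) := by
  intro t u
  have h := charFun_map_mul_comp (μ := P) (hX t).aemeasurable (-1) u
  simp only [neg_one_mul] at h
  rw [show dualProcess X t = fun ω => - X t ω from rfl, h, hθ t, hθ.neg]

section Exponent

variable {Ω : Type*} [MeasurableSpace Ω] {P : Measure Ω} [IsProbabilityMeasure P]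
  {X : ℝ≥0 → Ω → ℝ} {θ : ℝ → ℂ}

/-- Characteristic functions are bounded by `1`, in particular `|exp (θ u)| ≤ 1`. -/
theorem IsCharExponent.re_nonpos (hX : ∀ t, Measurable (X t)) (hθ : IsCharExponent X P θ)
    (u : ℝ) : (θ u).re ≤ 0 := by
  have := Measure.isProbabilityMeasure_map (μ := P) (hX 1).aemeasurable
  have h := norm_charFun_le_one (μ := P.map (X 1)) u
  rw [hθ 1 u, Complex.norm_exp] at h
  simpa using h

/-- The mean value inequality for `exp` on the half-plane `re ≤ 0`. -/
theorem norm_exp_mul_sub_one_le {a : ℂ} (ha : a.re ≤ 0) (t : ℝ≥0) :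
    ‖Complex.exp (((t : ℝ) : ℂ) * a) - 1‖ ≤ t * ‖a‖ := by
  have h := (convex_halfSpace_re_le 0).norm_image_sub_le_of_norm_hasDerivWithin_le (f := Complex.exp)
    (f' := Complex.exp) (C := 1) (x := 0) (y := ((t : ℝ) : ℂ) * a)
    (fun z _ => (Complex.hasDerivAt_exp z).hasDerivWithinAt)
    (fun z hz => by rw [Complex.norm_exp]; exact Real.exp_le_one_iff.2 hz)
    (by simp) (by simpa using mul_nonpos_of_nonneg_of_nonpos t.2 ha)
  simpa using h

theorem tendsto_exp_mul_sub_one_div (a : ℂ) :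
    Tendsto (fun t : ℝ≥0 => (Complex.exp (((t : ℝ) : ℂ) * a) - 1) / ((t : ℝ) : ℂ)) (𝓝[>] 0)
      (𝓝 a) := by
  have h : HasDerivAt (fun z : ℂ => Complex.exp (z * a)) a 0 := by
    simpa using ((hasDerivAt_id (0 : ℂ)).mul_const a).cexp
  have h2 : Tendsto (fun t : ℝ≥0 => ((t : ℝ) : ℂ)) (𝓝[>] 0) (𝓝[≠] 0) := by
    refine tendsto_nhdsWithin_iff.2 ⟨?_, ?_⟩
    · have : Continuous (fun t : ℝ≥0 => ((t : ℝ) : ℂ)) := by fun_prop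
      simpa using (this.tendsto 0).mono_left nhdsWithin_le_nhds
    · filter_upwards [self_mem_nhdsWithin] with t ht
      simpa using (show (0 : ℝ≥0) < t from ht).ne'
  refine ((hasDerivAt_iff_tendsto_slope.1 h).comp h2).congr fun t => ?_
  simp [slope_def_field]

/-- The exponent is the pointwise derivative at `t = 0` of the characteristic functions. -/
theorem IsCharExponent.measurable (hX : ∀ t, Measurable (X t)) (hθ : IsCharExponent X P θ) :
    Measurable θ := by
  refine measurable_of_tendsto_metrizable' (𝓝[>] (0 : ℝ≥0)) (fun t => ?_)
    (tendsto_pi_nhds.2 fun u => tendsto_exp_mul_sub_one_div (θ u))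
  have := Measure.isProbabilityMeasure_map (μ := P) (hX t).aemeasurable
  simp only [← hθ t]
  exact (measurable_charFun.sub_const 1).div_const _

/-- The transition semigroup acts on inverse Fourier transforms as multiplication by
`exp (t conj θ)`. -/
theorem transition_coe (hX : ∀ t, Measurable (X t)) (hθ : IsCharExponent X P θ)
    {ψ : ℝ → ℂ} (hψ : Integrable ψ) {H : ℝ → ℝ} (hH : ∀ x, (H x : ℂ) = invFourier ψ x)
    (t : ℝ≥0) (x : ℝ) :
    (transition X P t H x : ℂ) =
      invFourier (fun ξ => ψ ξ * Complex.exp (((t : ℝ) : ℂ) * conj (θ ξ))) x := by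
  rw [transition, ← integral_complex_ofReal]
  simp only [hH]
  rw [integral_invFourier_add (hX t) hψ]
  congr 1
  funext ξ
  rw [hθ t, ← Complex.exp_conj, map_mul, Complex.conj_ofReal]

theorem integrable_mul_exp_exponent (hX : ∀ t, Measurable (X t)) (hθ : IsCharExponent X P θ)
    {ψ : ℝ → ℂ} (hψ : Integrable ψ) (t : ℝ≥0) :
    Integrable (fun ξ => ψ ξ * Complex.exp (((t : ℝ) : ℂ) * conj (θ ξ))) := by
  have hm := (Complex.continuous_conj.measurable.comp (hθ.measurable hX))
  refine hψ.norm.mono' (hψ.aestronglyMeasurable.mul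
    (Measurable.aestronglyMeasurable (hm.const_mul _).cexp)) ?_
  filter_upwards with ξ
  rw [norm_mul, Complex.norm_exp]
  refine mul_le_of_le_one_right (norm_nonneg _) (Real.exp_le_one_iff.2 ?_)
  simpa using mul_nonpos_of_nonneg_of_nonpos t.2 (hθ.re_nonpos hX ξ)

theorem transition_sub_coe (hX : ∀ t, Measurable (X t)) (hθ : IsCharExponent X P θ)
    {ψ : ℝ → ℂ} (hψ : Integrable ψ) {H : ℝ → ℝ} (hH : ∀ x, (H x : ℂ) = invFourier ψ x)
    (t : ℝ≥0) (x : ℝ) :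
    ((transition X P t H x - H x : ℝ) : ℂ) =
      invFourier (fun ξ => ψ ξ * (Complex.exp (((t : ℝ) : ℂ) * conj (θ ξ)) - 1)) x := by
  rw [Complex.ofReal_sub, transition_coe hX hθ hψ hH, hH,
    invFourier_sub (integrable_mul_exp_exponent hX hθ hψ t) hψ]
  simp only [mul_sub, mul_one]

/-- If `ψ` and `ψ θ` are both integrable then the real inverse Fourier transform of `ψ` lies in
the domain of the generator: the integrands of the difference quotients converge in `L¹`, by
`norm_exp_mul_sub_one_le` and dominated convergence. -/
theorem mem_generatorDomain_of_integrable_mul (hX : ∀ t, Measurable (X t))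
    (hθ : IsCharExponent X P θ) {ψ : ℝ → ℂ} (hψ : Integrable ψ)
    (hψθ : Integrable (fun ξ => ψ ξ * conj (θ ξ))) {H : ℝ → ℝ}
    (hH : ∀ x, (H x : ℂ) = invFourier ψ x) : H ∈ generatorDomain X P := by
  obtain ⟨F, hF⟩ := exists_C0_eq_re_invFourier hψ
  obtain ⟨g, hg⟩ := exists_C0_eq_re_invFourier hψθ
  refine ⟨F, g, funext fun x => by rw [hF, ← hH, Complex.ofReal_re], ?_⟩
  have hre : ∀ ξ, (conj (θ ξ)).re ≤ 0 := fun ξ => by simpa using hθ.re_nonpos hX ξ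
  have hq : ∀ t : ℝ≥0, Integrable (fun ξ =>
      ψ ξ * (Complex.exp (((t : ℝ) : ℂ) * conj (θ ξ)) - 1) / ((t : ℝ) : ℂ)) := fun t => by
    simpa only [mul_sub, mul_one, Pi.sub_apply] using
      ((integrable_mul_exp_exponent hX hθ hψ t).sub hψ).div_const ((t : ℝ) : ℂ)
  set E : ℝ≥0 → ℝ := fun t => ∫ ξ,
    ‖ψ ξ * conj (θ ξ) - ψ ξ * (Complex.exp (((t : ℝ) : ℂ) * conj (θ ξ)) - 1) / ((t : ℝ) : ℂ)‖
    with hE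
  have hE0 : Tendsto E (𝓝[>] 0) (𝓝 0) := by
    rw [← integral_zero ℝ ℝ]
    refine tendsto_integral_filter_of_dominated_convergence
      (fun ξ => 2 * ‖ψ ξ * conj (θ ξ)‖) ?_ ?_ (hψθ.norm.const_mul 2) ?_
    · exact Eventually.of_forall fun t => ((hψθ.sub (hq t)).norm).aestronglyMeasurable
    · filter_upwards [self_mem_nhdsWithin] with t ht
      filter_upwards with ξ
      have ht' : (0 : ℝ) < t := ht
      rw [norm_norm, two_mul]
      refine (norm_sub_le _ _).trans (add_le_add le_rfl ?_)
      rw [norm_div, norm_mul, norm_mul, Complex.norm_real, Real.norm_of_nonneg ht'.le,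
        div_le_iff₀ ht', mul_assoc]
      refine mul_le_mul_of_nonneg_left ?_ (norm_nonneg _)
      rw [mul_comm ‖_‖ (t : ℝ)]
      exact norm_exp_mul_sub_one_le (hre ξ) t
    · filter_upwards with ξ
      have h := (tendsto_exp_mul_sub_one_div (conj (θ ξ))).const_mul (ψ ξ)
      have h2 := ((tendsto_const_nhds (x := ψ ξ * conj (θ ξ))).sub h).norm
      rw [sub_self, norm_zero] at h2
      simpa only [mul_div_assoc] using h2
  rw [Metric.tendstoUniformly_iff]
  intro ε hε
  filter_upwards [hE0.eventually (gt_mem_nhds hε)] with t ht x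
  refine lt_of_le_of_lt ?_ ht
  have hc : (transition X P t H x - H x) / (t : ℝ) = (invFourier (fun ξ =>
      ψ ξ * (Complex.exp (((t : ℝ) : ℂ) * conj (θ ξ)) - 1) / ((t : ℝ) : ℂ)) x).re := by
    rw [← invFourier_div_const, ← transition_sub_coe hX hθ hψ hH t x, ← Complex.ofReal_div,
      Complex.ofReal_re]
  rw [hc, hg, Real.dist_eq, ← Complex.sub_re, invFourier_sub hψθ (hq t)]
  exact (Complex.abs_re_le_norm _).trans (norm_invFourier_le _ x)

end Exponent

/-! ### Fourier transforms of densities -/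

theorem IsPositiveDensity.integrable {μ : Measure ℝ} [IsFiniteMeasure μ] {h : ℝ → ℝ}
    (hh : IsPositiveDensity μ h) : Integrable h := by
  obtain ⟨hm, hpos, hμ⟩ := hh
  refine ⟨hm.aestronglyMeasurable, ?_⟩
  rw [hasFiniteIntegral_iff_ofReal (ae_of_all _ fun x => (hpos x).le), ← setLIntegral_univ,
    ← withDensity_apply _ MeasurableSet.univ, ← hμ]
  exact measure_lt_top μ _

theorem IsPositiveDensity.charFun_eq {μ : Measure ℝ} {h : ℝ → ℝ}
    (hh : IsPositiveDensity μ h) (u : ℝ) :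
    charFun μ u = ∫ x : ℝ, (h x : ℂ) * Complex.exp (u * x * Complex.I) := by
  obtain ⟨hm, hpos, hμ⟩ := hh
  rw [charFun_apply_real, hμ, integral_withDensity_eq_integral_toReal_smul
    (by fun_prop) (ae_of_all _ fun x => ENNReal.ofReal_lt_top)]
  simp only [ENNReal.toReal_ofReal (hpos _).le, Complex.real_smul]

theorem integral_mul_exp_eq_fourier (f : ℝ → ℂ) (u : ℝ) :
    ∫ x : ℝ, f x * Complex.exp (u * x * Complex.I) = 𝓕 f (-u / (2 * Real.pi)) := by
  rw [Real.fourier_real_eq_integral_exp_smul]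
  congr 1
  funext x
  rw [smul_eq_mul, mul_comm]
  congr 2
  have : (Real.pi : ℂ) ≠ 0 := by exact_mod_cast Real.pi_ne_zero
  push_cast
  field_simp

/-- Fourier inversion: a continuous integrable function with integrable Fourier transform `F`
is the inverse Fourier transform of `F`. -/
theorem invFourier_integral_mul_exp {f F : ℝ → ℂ} (hfc : Continuous f) (hf : Integrable f)
    (hF : Integrable F) (hfF : ∀ᵐ u : ℝ, F u = ∫ x : ℝ, f x * Complex.exp (u * x * Complex.I))
    (x : ℝ) : invFourier F x = f x := by
  have h2π : (-(2 * Real.pi)) ≠ 0 := by simp [Real.pi_ne_zero]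
  have hπ : (Real.pi : ℂ) ≠ 0 := by exact_mod_cast Real.pi_ne_zero
  set G : ℝ → ℂ := fun u => 𝓕 f (-u / (2 * Real.pi)) with hG
  have hFG : F =ᵐ[volume] G := by
    filter_upwards [hfF] with u hu
    rw [hu, integral_mul_exp_eq_fourier]
  have hfou : ∀ v, 𝓕 f v = G (-(2 * Real.pi) * v) := fun v => by
    rw [hG]
    field_simp
  have hint : Integrable (𝓕 f) := by
    rw [show 𝓕 f = fun v => G (-(2 * Real.pi) * v) from funext hfou]
    exact (hF.congr hFG).comp_mul_left' h2π
  have hinv := congrFun (hfc.fourierInv_fourier_eq hf hint) x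
  rw [← hinv, Real.fourierInv_eq', invFourier]
  have hcv := Measure.integral_comp_mul_left
    (fun ξ : ℝ => G ξ * Complex.exp (-Complex.I * x * ξ)) (-(2 * Real.pi))
  rw [show (∫ ξ : ℝ, F ξ * Complex.exp (-Complex.I * x * ξ)) =
      ∫ ξ : ℝ, G ξ * Complex.exp (-Complex.I * x * ξ) from
      integral_congr_ae (hFG.mono fun u hu => by simp only [hu])]
  rw [abs_inv, abs_neg, abs_of_pos (by positivity : (0 : ℝ) < 2 * Real.pi)] at hcv
  rw [one_div, show ((2 * (Real.pi : ℂ))⁻¹) = (((2 * Real.pi)⁻¹ : ℝ) : ℂ) by push_cast; rfl,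
    ← Complex.real_smul, ← hcv]
  congr 1
  funext v
  rw [hfou, smul_eq_mul, mul_comm]
  congr 2
  simp only [RCLike.inner_apply, conj_trivial]
  push_cast
  ring

theorem iteratedDeriv_ofReal_comp {n : ℕ} {h : ℝ → ℝ} (hh : ContDiff ℝ n h) :
    iteratedDeriv n (fun x => (h x : ℂ)) = fun x => ((iteratedDeriv n h x : ℝ) : ℂ) := by
  funext x
  rw [iteratedDeriv_eq_iteratedFDeriv, iteratedDeriv_eq_iteratedFDeriv]
  have := Complex.ofRealCLM.iteratedFDeriv_comp_left (x := x) hh.contDiffAt (i := n) le_rfl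
  rw [show (fun x => (h x : ℂ)) = Complex.ofRealCLM ∘ h from rfl, this]
  rfl

/-- The Fourier transform of a density with two integrable derivatives decays quadratically. -/
theorem integrable_charFun_of_contDiff_two {μ : Measure ℝ} [IsProbabilityMeasure μ] {h : ℝ → ℝ}
    (hh : IsPositiveDensity μ h) (hc : ContDiff ℝ 2 h) (h1 : Integrable (iteratedDeriv 1 h))
    (h2 : Integrable (iteratedDeriv 2 h)) : Integrable (charFun μ) := by
  set f : ℝ → ℂ := fun x => (h x : ℂ) with hf
  have hcf : ContDiff ℝ 2 f := Complex.ofRealCLM.contDiff.comp hc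
  have hid : ∀ n : ℕ, n ≤ 2 → Integrable (iteratedDeriv n f) := by
    intro n hn
    rw [iteratedDeriv_ofReal_comp (hc.of_le (by exact_mod_cast hn))]
    refine Integrable.ofReal ?_
    interval_cases n
    · simpa using hh.integrable
    · exact h1
    · exact h2
  have key : ∀ u : ℝ, ‖charFun μ u‖ ≤ (1 + ∫ x, ‖iteratedDeriv 2 f x‖) * (1 + u ^ 2)⁻¹ := by
    intro u
    have h3 := congrFun (Real.fourier_iteratedDeriv (N := 2) (n := 2) hcf
      (fun n hn => hid n (by exact_mod_cast hn)) le_rfl) (-u / (2 * Real.pi))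
    rw [← integral_mul_exp_eq_fourier f, ← hh.charFun_eq] at h3
    have h4 : ‖𝓕 (iteratedDeriv 2 f) (-u / (2 * Real.pi))‖ ≤ ∫ x, ‖iteratedDeriv 2 f x‖ :=
      VectorFourier.norm_fourierIntegral_le_integral_norm _ _ _ _ _
    have hπ : (Real.pi : ℂ) ≠ 0 := by exact_mod_cast Real.pi_ne_zero
    have h5 : (2 * (Real.pi : ℂ) * Complex.I * ((-u / (2 * Real.pi) : ℝ) : ℂ)) =
        ((-u : ℝ) : ℂ) * Complex.I := by
      push_cast
      field_simp
    rw [h3, h5, norm_smul, norm_pow, norm_mul, Complex.norm_I, Complex.norm_real, mul_one,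
      Real.norm_eq_abs, sq_abs, neg_sq] at h4
    rw [← div_eq_mul_inv, le_div_iff₀ (by positivity)]
    have h6 := norm_charFun_le_one (μ := μ) u
    linarith
  exact (integrable_inv_one_add_sq.const_mul _).mono'
    measurable_charFun.aestronglyMeasurable (ae_of_all _ key)

/-! ### Zeros of the exponent -/

/-- If the characteristic function is `1` at `u`, the law is carried by `{x | u x ∈ 2πℤ}`. -/
theorem charFun_intCast_mul_eq_one {ν : Measure ℝ} [IsProbabilityMeasure ν] {u : ℝ}
    (h : charFun ν u = 1) (m : ℤ) : charFun ν (m * u) = 1 := by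
  have hcos : ∀ x : ℝ, (Complex.exp (u * x * Complex.I)).re = Real.cos (u * x) := fun x => by
    rw [← Complex.ofReal_mul, Complex.exp_ofReal_mul_I_re]
  have hi : Integrable (fun x : ℝ => Complex.exp (u * x * Complex.I)) ν := by
    refine Integrable.of_bound (by fun_prop) 1 (ae_of_all _ fun x => ?_)
    rw [← Complex.ofReal_mul, Complex.norm_exp_ofReal_mul_I]
  have h1 : ∫ x, Real.cos (u * x) ∂ν = 1 := by
    have := congrArg Complex.re h
    rw [charFun_apply_real] at this
    simp only [← hcos]
    rw [← Complex.one_re, ← this]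
    exact integral_re hi
  have hic : Integrable (fun x : ℝ => Real.cos (u * x)) ν := 
    hi.re.congr (ae_of_all _ hcos)
  -- A nonnegative function with vanishing integral, so `cos (u x) = 1` almost surely.
  have h2 : ∫ x, (1 - Real.cos (u * x)) ∂ν = 0 := by
    rw [integral_sub (integrable_const 1) hic, h1]
    simp
  have h3 := (integral_eq_zero_iff_of_nonneg
    (fun x => sub_nonneg.2 (Real.cos_le_one (u * x))) ((integrable_const 1).sub hic)).1 h2
  rw [charFun_apply_real, show (1 : ℂ) = ∫ _ : ℝ, 1 ∂ν by simp]
  refine integral_congr_ae ?_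
  filter_upwards [h3] with x hx
  obtain ⟨k, hk⟩ := (Real.cos_eq_one_iff (u * x)).1 (by simpa using (sub_eq_zero.1 hx).symm)
  rw [Complex.exp_eq_one_iff]
  refine ⟨m * k, ?_⟩
  have : ((m * u : ℝ) : ℂ) * x = m * (k * (2 * Real.pi)) := by
    rw [show ((m * u : ℝ) : ℂ) * x = m * ((u * x : ℝ) : ℂ) by push_cast; ring, ← hk]
    push_cast; ring
  rw [this]
  push_cast
  ring

/-- The zeros of a characteristic exponent are stable under integer multiplication. -/
theorem IsCharExponent.intCast_mul_eq_zero {Ω : Type*} [MeasurableSpace Ω] {P : Measure Ω}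
    [IsProbabilityMeasure P] {X : ℝ≥0 → Ω → ℝ} {θ : ℝ → ℂ} (hX : ∀ t, Measurable (X t))
    (hθ : IsCharExponent X P θ) {u : ℝ} (hu : θ u = 0) (m : ℤ) : θ (m * u) = 0 := by
  refine eq_of_exp_mul_eq fun t => ?_
  have := Measure.isProbabilityMeasure_map (μ := P) (hX t).aemeasurable
  rw [← hθ t, mul_zero, Complex.exp_zero]
  exact charFun_intCast_mul_eq_one (by rw [hθ t, hu]; simp) m

/-- Integrability of `1 / |θ|` at infinity forces `θ ≠ 0` almost everywhere on `(1, ∞)`, hence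
almost everywhere, as every nonzero zero has a multiple in `(1, ∞)` that is again a zero. -/
theorem IsCharExponent.ae_ne_zero {Ω : Type*} [MeasurableSpace Ω] {P : Measure Ω}
    [IsProbabilityMeasure P] {X : ℝ≥0 → Ω → ℝ} {θ : ℝ → ℂ} (hX : ∀ t, Measurable (X t))
    (hθ : IsCharExponent X P θ) (hint : ∫⁻ u in Set.Ioi (1 : ℝ), (‖θ u‖ₑ)⁻¹ < ∞) :
    ∀ᵐ u : ℝ, θ u ≠ 0 := by
  have h1 : volume {u : ℝ | 1 < u ∧ θ u = 0} = 0 := by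
    have h := ae_lt_top (hθ.measurable hX).enorm.inv hint.ne
    rw [ae_restrict_iff' measurableSet_Ioi, ae_iff] at h
    refine measure_mono_null (fun u hu => ?_) h
    simp only [Set.mem_ofPred_eq, Set.mem_Ioi, Classical.not_imp]
    exact ⟨hu.1, by simp [hu.2]⟩
  have hsub : {u : ℝ | ¬ θ u ≠ 0} ⊆ {0} ∪ ⋃ m : {m : ℤ // m ≠ 0},
      (fun u => ((m : ℤ) : ℝ) * u) ⁻¹' {u : ℝ | 1 < u ∧ θ u = 0} := by
    intro u hu
    rw [Set.mem_ofPred_eq, not_not] at hu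
    rcases eq_or_ne u 0 with rfl | h0
    · exact Or.inl rfl
    · right
      obtain ⟨m, hm⟩ : ∃ m : ℤ, 1 < (m : ℝ) * u := by
        obtain ⟨n, hn⟩ := exists_nat_gt |u|⁻¹
        rw [inv_lt_iff_one_lt_mul₀ (abs_pos.2 h0)] at hn
        rcases abs_cases u with ⟨ha, _⟩ | ⟨ha, _⟩
        · exact ⟨n, by rw [ha] at hn; push_cast; linarith⟩
        · exact ⟨-n, by rw [ha] at hn; push_cast; linarith⟩
      have hm0 : m ≠ 0 := by
        rintro rfl
        norm_num at hm
      exact Set.mem_iUnion.2 ⟨⟨m, hm0⟩, hm, hθ.intCast_mul_eq_zero hX hu m⟩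
  rw [ae_iff]
  refine measure_mono_null hsub (measure_union_null (by simp) (measure_iUnion_null fun m => ?_))
  rw [Real.volume_preimage_mul_left (by exact_mod_cast m.2), h1, mul_zero]

/-! ### Strong continuity of the transition functions -/

section Transition

variable {Ω : Type*} [MeasurableSpace Ω] {P : Measure Ω} [IsProbabilityMeasure P]
  {X : ℝ≥0 → Ω → ℝ} (g : ZeroAtInftyContinuousMap ℝ ℝ)

theorem integrable_comp_add {Z : Ω → ℝ} (hZ : Measurable Z) (x : ℝ) :
    Integrable (fun ω => g (Z ω + x)) P := by
  refine Integrable.of_bound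
    (g.continuous.measurable.comp (hZ.add_const x)).aestronglyMeasurable ‖g.toBCF‖
    (ae_of_all _ fun ω => g.toBCF.norm_coe_le_norm _)

/-- Stochastic continuity makes `t ↦ P_t g` continuous in the uniform norm. -/
theorem tendstoUniformly_transition (hX : ∀ t, Measurable (X t))
    (hc : ∀ t : ℝ≥0, TendstoInMeasure P X (𝓝 t) (X t)) (s : ℝ≥0) :
    TendstoUniformly (fun r => transition X P r g) (transition X P s g) (𝓝 s) := by
  rw [Metric.tendstoUniformly_iff]
  intro ε hε
  obtain ⟨δ, hδ, hgδ⟩ := Metric.uniformContinuous_iff.1 (ZeroAtInftyContinuousMap.uniformContinuous g)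
    (ε / 2) (half_pos hε)
  set M := ‖g.toBCF‖
  have hM : ∀ y, |g y| ≤ M := fun y => g.toBCF.norm_coe_le_norm y
  have h1 := (tendstoInMeasure_iff_measureReal_dist.1 (hc s) δ hδ).const_mul (2 * M)
  rw [mul_zero] at h1
  filter_upwards [h1.eventually (gt_mem_nhds (half_pos hε))] with r hr x
  -- Off the event `A`, whose probability is small, uniform continuity of `g` applies.
  set A : Set Ω := {ω | δ ≤ dist (X r ω) (X s ω)} with hA
  have hAm : MeasurableSet A := measurableSet_le measurable_const ((hX r).dist (hX s))
  rw [Real.dist_eq, abs_sub_comm, transition, transition,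
    ← integral_sub (integrable_comp_add g (hX r) x) (integrable_comp_add g (hX s) x)]
  refine (abs_integral_le_integral_abs).trans_lt ?_
  have hb : ∀ ω, |g (X r ω + x) - g (X s ω + x)| ≤ ε / 2 + A.indicator (fun _ => 2 * M) ω := by
    intro ω
    by_cases hω : ω ∈ A
    · rw [Set.indicator_of_mem hω]
      have := abs_sub (g (X r ω + x)) (g (X s ω + x))
      linarith [hM (X r ω + x), hM (X s ω + x)]
    · rw [Set.indicator_of_notMem hω, add_zero]
      refine (hgδ ?_).le
      rw [dist_add_right]
      exact not_le.1 hω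
  have hi : Integrable (A.indicator fun _ : Ω => 2 * M) P := (integrable_const _).indicator hAm
  calc ∫ ω, |g (X r ω + x) - g (X s ω + x)| ∂P
      ≤ ∫ ω, (ε / 2 + A.indicator (fun _ => 2 * M) ω) ∂P :=
        integral_mono ((integrable_comp_add g (hX r) x).sub (integrable_comp_add g (hX s) x)).abs
          ((integrable_const _).add hi) hb
    _ = ε / 2 + 2 * M * P.real A := by
        rw [integral_add (integrable_const _) hi, integral_indicator_const _ hAm]
        simp [mul_comm]
    _ < ε := by linarith

theorem continuous_transition {t : ℝ≥0} (hX : Measurable (X t)) :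
    Continuous (transition X P t g) := by
  refine continuous_of_dominated (bound := fun _ => ‖g.toBCF‖)
    (fun x => (integrable_comp_add g hX x).aestronglyMeasurable)
    (fun x => ae_of_all _ fun ω => g.toBCF.norm_coe_le_norm _) (integrable_const _)
    (ae_of_all _ fun ω => ?_)
  exact g.continuous.comp (by fun_prop)

theorem continuous_transition_prod (hX : ∀ t, Measurable (X t))
    (hc : ∀ t : ℝ≥0, TendstoInMeasure P X (𝓝 t) (X t)) :
    Continuous (fun p : ℝ≥0 × ℝ => transition X P p.1 g p.2) := by
  rw [continuous_iff_continuousAt]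
  rintro ⟨s, x⟩
  have hu := tendstoUniformly_transition g hX hc s
  rw [Metric.tendstoUniformly_iff] at hu
  rw [ContinuousAt, Metric.tendsto_nhds]
  intro ε hε
  have h2 := (continuous_transition g (P := P) (hX s)).continuousAt (x := x)
  rw [ContinuousAt, Metric.tendsto_nhds] at h2
  rw [nhds_prod_eq]
  filter_upwards [(hu (ε / 2) (half_pos hε)).prod_mk (h2 (ε / 2) (half_pos hε))] with p hp
  have := dist_triangle (transition X P p.1 g p.2) (transition X P s g p.2) (transition X P s g x)
  linarith [hp.1 p.2, hp.2, dist_comm (transition X P p.1 g p.2) (transition X P s g p.2)]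

/-! ### Fourier transforms of transition functions and of their time integrals -/

variable {g}

theorem integrable_comp_add_prod (hg : Integrable g) {Z : Ω → ℝ} (hZ : Measurable Z) :
    Integrable (fun p : Ω × ℝ => g (Z p.1 + p.2)) (P.prod volume) := by
  refine (integrable_prod_iff ?_).2 ⟨ae_of_all _ fun ω => hg.comp_add_left (Z ω), ?_⟩
  · exact (g.continuous.measurable.comp (by fun_prop)).aestronglyMeasurable
  · have h : ∀ ω, ∫ x, ‖g (Z ω + x)‖ = ∫ x, ‖g x‖ := fun ω =>
      integral_add_left_eq_self (fun x => ‖g x‖) (Z ω)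
    simp only [h]
    exact integrable_const _

theorem integrable_transition (hg : Integrable g) {t : ℝ≥0} (hX : Measurable (X t)) :
    Integrable (transition X P t g) :=
  (integrable_comp_add_prod hg hX).integral_prod_right

theorem integral_norm_transition_le (hg : Integrable g) {t : ℝ≥0} (hX : Measurable (X t)) :
    ∫ x, ‖transition X P t g x‖ ≤ ∫ x, ‖g x‖ := by
  have h := integrable_comp_add_prod (P := P) hg hX
  calc ∫ x, ‖transition X P t g x‖ ≤ ∫ x, ∫ ω, ‖g (X t ω + x)‖ ∂P :=
        integral_mono (integrable_transition hg hX).norm h.norm.integral_prod_right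
          fun x => norm_integral_le_integral_norm _
    _ = ∫ ω, (∫ x, ‖g (X t ω + x)‖) ∂P := (integral_integral_swap h.norm).symm
    _ = ∫ x, ‖g x‖ := by
        have h : ∀ ω, ∫ x, ‖g (X t ω + x)‖ = ∫ x, ‖g x‖ := fun ω =>
          integral_add_left_eq_self (fun x => ‖g x‖) (X t ω)
        simp only [h, integral_const, probReal_univ, one_smul]

theorem integral_transition_mul_exp (hX : ∀ t, Measurable (X t)) {θ : ℝ → ℂ}
    (hθ : IsCharExponent X P θ) (hg : Integrable g) (t : ℝ≥0) (u : ℝ) :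
    ∫ x : ℝ, (transition X P t g x : ℂ) * Complex.exp (u * x * Complex.I) =
      (∫ x : ℝ, (g x : ℂ) * Complex.exp (u * x * Complex.I)) *
        Complex.exp (((t : ℝ) : ℂ) * conj (θ u)) := by
  have hprod : Integrable (fun p : Ω × ℝ => (g (X t p.1 + p.2) : ℂ) *
      Complex.exp (u * p.2 * Complex.I)) (P.prod volume) := by
    have h := (integrable_comp_add_prod (P := P) hg (hX t)).ofReal (𝕜 := ℂ)
    refine h.norm.mono' (h.aestronglyMeasurable.mul (by fun_prop)) (ae_of_all _ fun p => ?_)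
    rw [norm_mul, ← Complex.ofReal_mul, Complex.norm_exp_ofReal_mul_I, mul_one]
    rfl
  have hinner : ∀ ω, ∫ x : ℝ, (g (X t ω + x) : ℂ) * Complex.exp (u * x * Complex.I) =
      (∫ x : ℝ, (g x : ℂ) * Complex.exp (u * x * Complex.I)) *
        Complex.exp ((-u : ℝ) * X t ω * Complex.I) := by
    intro ω
    rw [← integral_add_left_eq_self (fun x : ℝ => (g x : ℂ) * Complex.exp (u * x * Complex.I))
      (X t ω), ← integral_mul_const]
    congr 1
    funext x
    rw [mul_assoc (g (X t ω + x) : ℂ), ← Complex.exp_add]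
    congr 2
    push_cast
    ring
  calc ∫ x : ℝ, (transition X P t g x : ℂ) * Complex.exp (u * x * Complex.I)
      = ∫ x : ℝ, ∫ ω, (g (X t ω + x) : ℂ) * Complex.exp (u * x * Complex.I) ∂P := by
        congr 1
        funext x
        rw [transition, ← integral_complex_ofReal, integral_mul_const]
    _ = ∫ ω, (∫ x : ℝ, (g (X t ω + x) : ℂ) * Complex.exp (u * x * Complex.I)) ∂P :=
        (integral_integral_swap hprod).symm
    _ = _ := by
        simp only [hinner]
        rw [integral_const_mul, show ((t : ℝ) : ℂ) * conj (θ u) = conj (((t : ℝ) : ℂ) * θ u) by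
          simp, Complex.exp_conj, ← hθ t, ← charFun_neg, charFun_apply_real,
          integral_map (hX t).aemeasurable (by fun_prop)]

/-- The time integral `∫₀ᵗ P_s g (x) ds` of the transition semigroup. -/
noncomputable def timeIntegral (X : ℝ≥0 → Ω → ℝ) (P : Measure Ω) (g : ℝ → ℝ) (t : ℝ≥0)
    (x : ℝ) : ℝ :=
  ∫ s in (0 : ℝ)..t, transition X P s.toNNReal g x

theorem integrable_transition_prod (hX : ∀ t, Measurable (X t))
    (hc : ∀ t : ℝ≥0, TendstoInMeasure P X (𝓝 t) (X t)) (hg : Integrable g) (t : ℝ≥0) :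
    Integrable (fun p : ℝ × ℝ => transition X P p.1.toNNReal g p.2)
      ((volume.restrict (Set.Ioc (0 : ℝ) t)).prod volume) := by
  have hcont : Continuous (fun p : ℝ × ℝ => transition X P p.1.toNNReal g p.2) :=
    (continuous_transition_prod g hX hc).comp
      ((continuous_real_toNNReal.comp continuous_fst).prodMk continuous_snd)
  refine (integrable_prod_iff hcont.aestronglyMeasurable).2
    ⟨ae_of_all _ fun s => integrable_transition (P := P) hg (hX s.toNNReal), ?_⟩
  refine Integrable.of_bound
    (hcont.stronglyMeasurable.norm.integral_prod_right).aestronglyMeasurable (∫ x, ‖g x‖)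
    (ae_of_all _ fun s => ?_)
  rw [Real.norm_of_nonneg (integral_nonneg fun x => norm_nonneg _)]
  exact integral_norm_transition_le (P := P) hg (hX s.toNNReal)

theorem continuous_timeIntegral (hX : ∀ t, Measurable (X t))
    (hc : ∀ t : ℝ≥0, TendstoInMeasure P X (𝓝 t) (X t)) (t : ℝ≥0) :
    Continuous (timeIntegral X P g t) := by
  refine intervalIntegral.continuous_parametric_intervalIntegral_of_continuous'
    (f := fun x s => transition X P (Real.toNNReal s) g x) ?_ 0 (t : ℝ)
  exact (continuous_transition_prod g hX hc).comp
    ((continuous_real_toNNReal.comp continuous_snd).prodMk continuous_fst)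

theorem integrable_timeIntegral (hX : ∀ t, Measurable (X t))
    (hc : ∀ t : ℝ≥0, TendstoInMeasure P X (𝓝 t) (X t)) (hg : Integrable g) (t : ℝ≥0) :
    Integrable (timeIntegral X P g t) := by
  have h := (integrable_transition_prod hX hc hg t).integral_prod_right
  refine h.congr (ae_of_all _ fun x => ?_)
  simp only [timeIntegral]
  rw [intervalIntegral.integral_of_le t.coe_nonneg]

/-- The identity `a ∫₀ᵗ exp (s a) ds = exp (t a) - 1`, valid for `a = 0` too. -/
theorem mul_integral_exp_mul (a : ℂ) (t : ℝ) :
    a * ∫ s in (0 : ℝ)..t, Complex.exp ((s : ℂ) * a) = Complex.exp ((t : ℂ) * a) - 1 := by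
  rcases eq_or_ne a 0 with rfl | ha
  · simp
  · simp only [mul_comm _ a]
    rw [integral_exp_mul_complex ha]
    simp [mul_div_cancel₀ _ ha]

theorem integral_timeIntegral_mul_exp (hX : ∀ t, Measurable (X t))
    (hc : ∀ t : ℝ≥0, TendstoInMeasure P X (𝓝 t) (X t)) {θ : ℝ → ℂ}
    (hθ : IsCharExponent X P θ) (hg : Integrable g) (t : ℝ≥0) (u : ℝ) :
    ∫ x : ℝ, (timeIntegral X P g t x : ℂ) * Complex.exp (u * x * Complex.I) =
      (∫ x : ℝ, (g x : ℂ) * Complex.exp (u * x * Complex.I)) *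
        ∫ s in (0 : ℝ)..t, Complex.exp ((s : ℂ) * conj (θ u)) := by
  have hprod : Integrable (fun p : ℝ × ℝ => (transition X P p.1.toNNReal g p.2 : ℂ) *
      Complex.exp (u * p.2 * Complex.I)) ((volume.restrict (Set.Ioc (0 : ℝ) t)).prod volume) := by
    have h := (integrable_transition_prod hX hc hg t).ofReal (𝕜 := ℂ)
    refine h.norm.mono' (h.aestronglyMeasurable.mul (by fun_prop)) (ae_of_all _ fun p => ?_)
    rw [norm_mul, ← Complex.ofReal_mul, Complex.norm_exp_ofReal_mul_I, mul_one]
    rfl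
  calc ∫ x : ℝ, (timeIntegral X P g t x : ℂ) * Complex.exp (u * x * Complex.I)
      = ∫ x : ℝ, ∫ s in Set.Ioc (0 : ℝ) t, (transition X P s.toNNReal g x : ℂ) *
          Complex.exp (u * x * Complex.I) := by
        congr 1
        funext x
        rw [timeIntegral, intervalIntegral.integral_of_le t.coe_nonneg, ← integral_complex_ofReal,
          integral_mul_const]
    _ = ∫ s in Set.Ioc (0 : ℝ) t, ∫ x : ℝ, (transition X P s.toNNReal g x : ℂ) *
          Complex.exp (u * x * Complex.I) := (integral_integral_swap hprod).symm
    _ = ∫ s in Set.Ioc (0 : ℝ) t, (∫ x : ℝ, (g x : ℂ) * Complex.exp (u * x * Complex.I)) *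
          Complex.exp ((s : ℂ) * conj (θ u)) := by
        refine setIntegral_congr_fun measurableSet_Ioc fun s hs => ?_
        rw [integral_transition_mul_exp hX hθ hg, Real.coe_toNNReal s hs.1.le]
    _ = _ := by
        rw [integral_const_mul, intervalIntegral.integral_of_le t.coe_nonneg]

/-- Averages of `P_s g` over short times converge uniformly to `g`. -/
theorem tendstoUniformly_timeIntegral_div (hX : ∀ t, Measurable (X t))
    (h0 : ∀ᵐ ω ∂P, X 0 ω = 0) (hc : ∀ t : ℝ≥0, TendstoInMeasure P X (𝓝 t) (X t)) :
    TendstoUniformly (fun (t : ℝ≥0) (x : ℝ) => timeIntegral X P g t x / (t : ℝ)) g (𝓝[>] 0) := by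
  have hu := tendstoUniformly_transition g hX hc 0
  have hg0 : transition X P 0 g = g := by
    funext x
    rw [transition, integral_congr_ae (g := fun _ => g x)
      (h0.mono fun ω hω => by simp only [hω, zero_add])]
    simp
  rw [hg0, Metric.tendstoUniformly_iff] at hu
  rw [Metric.tendstoUniformly_iff]
  intro ε hε
  obtain ⟨δ, hδ, hball⟩ := Metric.eventually_nhds_iff.1 (hu (ε / 2) (half_pos hε))
  filter_upwards [self_mem_nhdsWithin, mem_nhdsWithin_of_mem_nhds (Metric.ball_mem_nhds 0 hδ)]
    with t ht htδ x
  have ht' : (0 : ℝ) < t := ht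
  have hts : (t : ℝ) < δ := by
    simpa [NNReal.dist_eq] using htδ
  have hcont : Continuous (fun s : ℝ => transition X P s.toNNReal g x) :=
    (continuous_transition_prod g hX hc).comp
      (continuous_real_toNNReal.prodMk continuous_const)
  have hb : ‖∫ s in (0 : ℝ)..t, (transition X P s.toNNReal g x - g x)‖ ≤ ε / 2 * |(t : ℝ) - 0| := by
    refine intervalIntegral.norm_integral_le_of_norm_le_const fun s hs => ?_
    rw [Set.uIoc_of_le ht'.le] at hs
    rw [← dist_eq_norm, dist_comm]
    refine (hball ?_ x).le
    rw [NNReal.dist_eq, Real.coe_toNNReal s hs.1.le, NNReal.coe_zero, sub_zero, abs_of_pos hs.1]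
    exact hs.2.trans_lt hts
  rw [intervalIntegral.integral_sub (hcont.intervalIntegrable _ _) (by simp),
    intervalIntegral.integral_const, sub_zero, abs_of_pos ht', smul_eq_mul] at hb
  rw [dist_comm, Real.dist_eq, div_sub' ht'.ne', abs_div, abs_of_pos ht', div_lt_iff₀ ht']
  refine lt_of_le_of_lt hb ?_
  nlinarith

/-- If `ψ` is integrable and `ψ conj θ` is the Fourier transform of an integrable `g ∈ C₀(ℝ)`,
then the real inverse Fourier transform `H` of `ψ` lies in the domain of the generator: Fourier
inversion gives Dynkin's formula `P_t H - H = ∫₀ᵗ P_s g ds`. -/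
theorem mem_generatorDomain_of_fourier_eq (hX : ∀ t, Measurable (X t))
    (h0 : ∀ᵐ ω ∂P, X 0 ω = 0) (hc : ∀ t : ℝ≥0, TendstoInMeasure P X (𝓝 t) (X t)) {θ : ℝ → ℂ}
    (hθ : IsCharExponent X P θ) (hg : Integrable g) {ψ : ℝ → ℂ} (hψ : Integrable ψ)
    (hψg : ∀ᵐ u : ℝ, ψ u * conj (θ u) = ∫ x : ℝ, (g x : ℂ) * Complex.exp (u * x * Complex.I))
    {H : ℝ → ℝ} (hH : ∀ x, (H x : ℂ) = invFourier ψ x) : H ∈ generatorDomain X P := by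
  obtain ⟨F, hF⟩ := exists_C0_eq_re_invFourier hψ
  refine ⟨F, g, funext fun x => by rw [hF, ← hH, Complex.ofReal_re], ?_⟩
  convert tendstoUniformly_timeIntegral_div (g := g) hX h0 hc using 5 with t x
  rw [← Complex.ofReal_inj, transition_sub_coe hX hθ hψ hH]
  refine invFourier_integral_mul_exp (f := fun x => (timeIntegral X P g t x : ℂ))
    (Complex.continuous_ofReal.comp (continuous_timeIntegral hX hc t))
    (integrable_timeIntegral hX hc hg t).ofReal ?_ ?_ x
  · simp only [mul_sub, mul_one]
    exact (integrable_mul_exp_exponent hX hθ hψ t).sub hψ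
  · filter_upwards [hψg] with u hu
    rw [integral_timeIntegral_mul_exp hX hc hθ hg, ← hu, mul_assoc, mul_integral_exp_mul]

end Transition

/-! ### Membership of the potential in the domain -/

variable {Ω : Type*} [MeasurableSpace Ω] {P : Measure Ω} {X : ℝ≥0 → Ω → ℝ} {η : ℝ → ℂ}

theorem IsSymmetricProcess.conj_exponent (hX : ∀ t, Measurable (X t))
    (hs : IsSymmetricProcess X P) (hη : IsCharExponent X P η) (u : ℝ) : conj (η u) = η u :=
  eq_of_exp_mul_eq fun t => by rw [← hη t u, ← hη.dual hX t u, ← hs t]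

theorem tendstoInMeasure_dualProcess {t : ℝ≥0} (h : TendstoInMeasure P X (𝓝 t) (X t)) :
    TendstoInMeasure P (dualProcess X) (𝓝 t) (dualProcess X t) := by
  rw [tendstoInMeasure_iff_dist] at h ⊢
  simpa only [dualProcess, dist_neg_neg] using h

theorem IsC0n.exists_C0 {n : ℕ} {h : ℝ → ℝ} (hh : IsC0n n h) :
    ∃ F : ZeroAtInftyContinuousMap ℝ ℝ, ⇑F = h :=
  ⟨⟨⟨h, hh.1.continuous⟩, by simpa only [iteratedDeriv_zero] using hh.2 0 n.zero_le⟩, rfl⟩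

/-- The bounds hold for `a = 0` as well, where `φ / a` is `0`. -/
theorem norm_div_mul_self_le (φ a : ℂ) : ‖φ / a * a‖ ≤ ‖φ‖ ∧ ‖φ / a * conj a‖ ≤ ‖φ‖ := by
  rcases eq_or_ne a 0 with rfl | ha
  · simp
  · have : ‖a‖ ≠ 0 := norm_ne_zero_iff.2 ha
    simp only [norm_mul, norm_div, Complex.norm_conj, div_mul_cancel₀ _ this, le_refl, and_self]

variable {μ₀ μ₁ : Measure ℝ}

/-- The case of an integrable difference `μ̂₁ - μ̂₀`, common to processes of type 0 and D. -/
theorem potential_mem_of_integrable_charFun_sub [IsProbabilityMeasure P]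
    (hX : ∀ t, Measurable (X t)) (hη : IsCharExponent X P η)
    (hψ : Integrable (fun ξ : ℝ => (charFun μ₁ ξ - charFun μ₀ ξ) / η ξ))
    (hφ : Integrable (fun ξ : ℝ => charFun μ₁ ξ - charFun μ₀ ξ)) :
    potential μ₀ μ₁ η ∈ generatorDomain X P ∩ generatorDomain (dualProcess X) P := by
  have hH : ∀ x, (potential μ₀ μ₁ η x : ℂ) =
      invFourier (fun ξ => (charFun μ₁ ξ - charFun μ₀ ξ) / η ξ) x :=
    potential_coe hη μ₀ μ₁
  have hm := hη.measurable hX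
  refine ⟨mem_generatorDomain_of_integrable_mul hX hη hψ (hφ.norm.mono' ?_ ?_) hH,
    mem_generatorDomain_of_integrable_mul (fun t => (hX t).neg) (hη.dual hX) hψ
      (hφ.norm.mono' ?_ ?_) hH⟩
  · exact hψ.aestronglyMeasurable.mul
      (Complex.continuous_conj.measurable.comp hm).aestronglyMeasurable
  · exact ae_of_all _ fun ξ => (norm_div_mul_self_le _ _).2
  · simp only [Complex.conj_conj]
    exact hψ.aestronglyMeasurable.mul hm.aestronglyMeasurable
  · simp only [Complex.conj_conj]
    exact ae_of_all _ fun ξ => (norm_div_mul_self_le _ _).1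

/-- The case of type S: no integrability of `μ̂₁ - μ̂₀` is available, but since `η` is real, it is
`η` times the integrand of the potential, and it is the Fourier transform of `h₁ - h₀`. -/
theorem potential_mem_of_isTypeS [IsProbabilityMeasure P] [IsProbabilityMeasure μ₀]
    [IsProbabilityMeasure μ₁] (hL : IsLevyProcess X P)
    (hη : IsCharExponent X P η) (hS : IsTypeS X P η) {h₀ h₁ : ℝ → ℝ}
    (hh₀ : IsPositiveDensity μ₀ h₀) (hh₁ : IsPositiveDensity μ₁ h₁) (hc₀ : IsC0n 0 h₀)
    (hc₁ : IsC0n 0 h₁)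
    (hψ : Integrable (fun ξ : ℝ => (charFun μ₁ ξ - charFun μ₀ ξ) / η ξ)) :
    potential μ₀ μ₁ η ∈ generatorDomain X P ∩ generatorDomain (dualProcess X) P := by
  obtain ⟨g₀, rfl⟩ := hc₀.exists_C0
  obtain ⟨g₁, rfl⟩ := hc₁.exists_C0
  have hX := hL.measurable
  have hreal := hS.1.conj_exponent hX hη
  have hH : ∀ x, (potential μ₀ μ₁ η x : ℂ) =
      invFourier (fun ξ => (charFun μ₁ ξ - charFun μ₀ ξ) / η ξ) x :=
    potential_coe hη μ₀ μ₁
  have hint : ∀ (g : ZeroAtInftyContinuousMap ℝ ℝ) (u : ℝ), Integrable g →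
      Integrable (fun x : ℝ => (g x : ℂ) * Complex.exp (u * x * Complex.I)) := by
    intro g u hg
    refine hg.norm.mono' (hg.ofReal.aestronglyMeasurable.mul (by fun_prop)) (ae_of_all _ fun x => ?_)
    rw [norm_mul, ← Complex.ofReal_mul, Complex.norm_exp_ofReal_mul_I, mul_one, Complex.norm_real]
  have hg : Integrable (g₁ - g₀ : ZeroAtInftyContinuousMap ℝ ℝ) := hh₁.integrable.sub hh₀.integrable
  have hfou : ∀ᵐ u : ℝ, (charFun μ₁ u - charFun μ₀ u) / η u * η u =
      ∫ x : ℝ, (((g₁ - g₀ : ZeroAtInftyContinuousMap ℝ ℝ) x : ℝ) : ℂ) *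
        Complex.exp (u * x * Complex.I) := by
    filter_upwards [hη.ae_ne_zero hX hS.2] with u hu
    rw [div_mul_cancel₀ _ hu, hh₁.charFun_eq, hh₀.charFun_eq,
      ← integral_sub (hint g₁ u hh₁.integrable) (hint g₀ u hh₀.integrable)]
    simp only [ZeroAtInftyContinuousMap.sub_apply, Complex.ofReal_sub, sub_mul]
  refine ⟨mem_generatorDomain_of_fourier_eq hX hL.start_zero hL.stochastically_continuous hη hg hψ
    (by simpa only [hreal] using hfou) hH,
    mem_generatorDomain_of_fourier_eq (fun t => (hX t).neg) ?_
      (fun t => tendstoInMeasure_dualProcess (hL.stochastically_continuous t)) (hη.dual hX) hg hψ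
      (by simpa only [Complex.conj_conj] using hfou) hH⟩
  filter_upwards [hL.start_zero] with ω hω
  exact neg_eq_zero.2 hω

end LevySEP

theorem mainTheorem4 {Ω : Type*} [MeasurableSpace Ω] (P : Measure Ω) [IsProbabilityMeasure P]
    (L : ℝ≥0 → Ω → ℝ) (hL : LevySEP.IsLevyProcess L P)
    (hL_nonconst : ¬ ∀ t : ℝ≥0, ∀ᵐ ω ∂P, L t ω = 0)
    (η : ℝ → ℂ) (hη : LevySEP.IsCharExponent L P η)
    (μ₀ μ₁ : Measure ℝ) [IsProbabilityMeasure μ₀] [IsProbabilityMeasure μ₁]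
    (h₀ h₁ : ℝ → ℝ) (hh₀ : LevySEP.IsPositiveDensity μ₀ h₀) (hh₁ : LevySEP.IsPositiveDensity μ₁ h₁)
    (hreg : LevySEP.RegularityAssumption L P η μ₀ μ₁ h₀ h₁)
    (hcond : LevySEP.EmbeddingCondition μ₀ μ₁ η) :
    LevySEP.potential μ₀ μ₁ η ∈
      LevySEP.generatorDomain L P ∩ LevySEP.generatorDomain (LevySEP.dualProcess L) P := by
  have hψ := hcond.1
  rcases hreg with ⟨hS, hc₀, hc₁⟩ | ⟨-, ⟨hc₀, h01, h02⟩, hc₁, h11, h12⟩ | ⟨-, hc, hsupp⟩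
  · exact LevySEP.potential_mem_of_isTypeS hL hη hS hh₀ hh₁ hc₀ hc₁ hψ
  · exact LevySEP.potential_mem_of_integrable_charFun_sub hL.measurable hη hψ
      ((LevySEP.integrable_charFun_of_contDiff_two hh₁ hc₁.1 h11 h12).sub
        (LevySEP.integrable_charFun_of_contDiff_two hh₀ hc₀.1 h01 h02))
  · exact LevySEP.potential_mem_of_integrable_charFun_sub hL.measurable hη hψ
      (hc.integrable_of_hasCompactSupport hsupp)
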